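/- Let $k$ be a field, let $n$ be a natural number, let $\Lambda_n = k[x]/\langle x^n\rangle$, and for $0\le i\le n$ let $[i] = k[x]/\langle x^i\rangle$, regarded as a $\Lambda_n$-module; so $[0]=0$, and for $i\ge 1$ this is the indecomposable $\Lambda_n$-module of length $i$. Let $E=\bigoplus_{i=1}^n [i]$ and let $A_n = \operatorname{End}_{\Lambda_n}(E)^{\mathrm{op}}$ be the Auslander algebra of $\Lambda_n$. Modules are left modules. For $0\le i\le n$ let $P(i)=\operatorname{Hom}_{\Lambda_n}(E,[i])$, an $A_n$-module; the inclusions $[i]\to[i+1]$ (multiplication by $x$) yield a chain $0=P(0)\subset P(1)\subset\dots\subset P(n)$. For $1\le i\le n$ put $\Delta(i)=P(i)/P(i-1)$ and $T(i)=P(n)/P(i-1)$, and let $T=\bigoplus_{i=1}^n T(i)$. Then for every finitely generated $A_n$-module $M$ the following conditions are equivalent: (i) $M$ is torsionless, i.e. for every $0\ne m\in M$ there is an $A_n$-linear map $f\colon M\to A_n$ with $f(m)\neq 0$ (equivalently, as $M$ is finitely generated, $M$ embeds into a projective $A_n$-module); (ii) $\operatorname{Ext}^1_{A_n}(M,T)=0$;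 (iii) $M$ has a $\Delta$-filtration, i.e. there is a finite chain of submodules $0=M_0\subseteq M_1\subseteq\dots\subseteq M_m=M$ such that each $M_j/M_{j-1}$ is isomorphic to some $\Delta(i)$ with $1\le i\le n$; (iv) the projective dimension of $M$ is at most $1$; (v) the injective envelope of $M$ is projective. -/

import Mathlib

open CategoryTheory

universe u

namespace AuslanderNilpotent

section HomModule

variable {R : Type*} [CommRing R] {E : Type*} [AddCommGroup E] [Module R E]
  {X : Type*} [AddCommGroup X] [Module R X] {Y : Type*} [AddCommGroup Y] [Module R Y]

/-- `Hom_R(E, X)` as a left module over `End_R(E)ᵒᵖ`: endomorphisms of `E` act by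
precomposition. -/
instance homModule : Module (Module.End R E)ᵐᵒᵖ (E →ₗ[R] X) where
  smul a f := f.comp a.unop
  one_smul _ := rfl
  mul_smul _ _ _ := rfl
  smul_zero _ := LinearMap.zero_comp _
  smul_add _ _ _ := LinearMap.add_comp _ _ _
  add_smul _ _ _ := LinearMap.comp_add _ _ _
  zero_smul _ := LinearMap.comp_zero _

/-- The map `Hom_R(E, g) : Hom_R(E, X) → Hom_R(E, Y)` of left `End_R(E)ᵒᵖ`-modules. -/
def homMap (E : Type*) [AddCommGroup E] [Module R E] (g : X →ₗ[R] Y) :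
    (E →ₗ[R] X) →ₗ[(Module.End R E)ᵐᵒᵖ] (E →ₗ[R] Y) where
  toFun f := g.comp f
  map_add' _ _ := LinearMap.comp_add _ _ _
  map_smul' _ _ := rfl

end HomModule

noncomputable section Algebra

variable (k : Type u) [Field k] (n : ℕ)

/-- The truncated polynomial algebra `Λ_n = k[x] / ⟨x ^ n⟩`. -/
abbrev Lam : Type u := AdjoinRoot ((Polynomial.X : Polynomial k) ^ n)

/-- The class of `x` in `Λ_n`. -/
abbrev x : Lam k n := AdjoinRoot.root ((Polynomial.X : Polynomial k) ^ n)

/-- The `Λ_n`-module `[i] = Λ_n / ⟨x ^ i⟩`. For `0 ≤ i ≤ n` it is isomorphic to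
`k[x] / ⟨x ^ i⟩`; for `1 ≤ i ≤ n` it is the indecomposable `Λ_n`-module of length `i`. -/
def Ind (i : ℕ) : Type u := Lam k n ⧸ (Ideal.span {x k n ^ i} : Ideal (Lam k n))

instance (i : ℕ) : AddCommGroup (Ind k n i) := Submodule.Quotient.addCommGroup _

instance (i : ℕ) : Module (Lam k n) (Ind k n i) := Submodule.Quotient.module _

/-- The map `[j] → [i]` given by multiplication by `x ^ (i - j)`. For `j ≤ i ≤ n` it is the
inclusion of `[j]` as the submodule of length `j` of `[i]`; only that case is used. -/
def incl (j i : ℕ) : Ind k n j →ₗ[Lam k n] Ind k n i :=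
  Submodule.mapQ (Ideal.span {x k n ^ j}) (Ideal.span {x k n ^ i})
    (LinearMap.mulLeft (Lam k n) (x k n ^ (i - j))) (by
      rw [Ideal.span_le, Set.singleton_subset_iff]
      change x k n ^ (i - j) * x k n ^ j ∈ Ideal.span {x k n ^ i}
      rw [← pow_add, Ideal.mem_span_singleton]
      exact pow_dvd_pow _ (by omega))

/-- The minimal Auslander generator `E = [1] ⊕ ⋯ ⊕ [n]` of `Λ_n`. -/
def E : Type u := (i : Fin n) → Ind k n (i + 1)

instance : AddCommGroup (E k n) := Pi.addCommGroup

instance : Module (Lam k n) (E k n) := Pi.module _ _ _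

/-- The Auslander algebra `A_n = End(E)ᵒᵖ` of `Λ_n`. -/
abbrev A : Type u := (Module.End (Lam k n) (E k n))ᵐᵒᵖ

/-- The left `A_n`-module `P(i) = Hom(E, [i])`. -/
abbrev P (i : ℕ) : Type u := E k n →ₗ[Lam k n] Ind k n i

/-- `P(j)`, viewed as a submodule of `P(i)` for `j ≤ i ≤ n` through the inclusion
`[j] → [i]`. -/
def PSub (j i : ℕ) : Submodule (A k n) (P k n i) :=
  LinearMap.range (homMap (E k n) (incl k n j i))

/-- The standard modules: `Δ(i + 1) = P(i + 1) / P(i)` for `0 ≤ i < n`, where `P(0) = 0`. -/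
abbrev Delta (i : Fin n) : Type u := P k n (i + 1) ⧸ PSub k n i (i + 1)

/-- The modules `T(i + 1) = P(n) / P(i)` for `0 ≤ i < n`, where `P(0) = 0`. -/
abbrev TSummand (i : Fin n) : Type u := P k n n ⧸ PSub k n i n

/-- The characteristic tilting module `T = T(1) ⊕ ⋯ ⊕ T(n)`. -/
abbrev T : Type u := (i : Fin n) → TSummand k n i

/-- `M` has a `Δ`-filtration: a finite chain of submodules from `0` to `M` all of whose
successive factors are isomorphic to modules `Δ(i)`. -/
def HasDeltaFiltration (M : Type*) [AddCommGroup M] [Module (A k n) M] : Prop :=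
  ∃ (m : ℕ) (F : ℕ → Submodule (A k n) M), Monotone F ∧ F 0 = ⊥ ∧ F m = ⊤ ∧
    ∀ j < m, ∃ i : Fin n,
      Nonempty ((F (j + 1) ⧸ (F j).submoduleOf (F (j + 1))) ≃ₗ[A k n] Delta k n i)

end Algebra

section Envelope

variable (R : Type*) [Ring R]

/-- A module is torsionless if its elements are separated by linear maps to the ring; that is,
the canonical map to the bidual is injective. -/
def IsTorsionless (M : Type*) [AddCommGroup M] [Module R M] : Prop :=
  ∀ m : M, (∀ f : M →ₗ[R] R, f m = 0) → m = 0

/-- `ι : M → I` is an injective envelope of `M`: an essential monomorphism to an injective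
module. -/
structure IsInjectiveEnvelope {R : Type u} [Ring R] {M I : Type u} [AddCommGroup M] [Module R M]
    [AddCommGroup I] [Module R I] (ι : M →ₗ[R] I) : Prop where
  injective_module : Module.Injective R I
  injective : Function.Injective ι
  essential : ∀ N : Submodule R I, N ⊓ LinearMap.range ι = ⊥ → N = ⊥

end Envelope

end AuslanderNilpotent

/-! Let ε be the idempotent of A_n belonging to the summand [n] ≅ Λ_n of E. All five conditions
amount to one more, `IsSeparated`: no nonzero submodule of M is killed by ε. The exact functor M ↦
εM to Λ_n-modules has the right adjoint X ↦ Hom(E, X), so Hom(E, -) preserves injectives, every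
Hom(E, X) is separated, and a separated M embeds in Hom(E, εM).

A separated M inherits structure from Λ_n-modules. An essential embedding of εM into a power of the
injective module [n] yields an injective envelope of M that is a power of P(n), hence projective
(`exists_injectiveEnvelope_projective`). A composition series yields a Δ-filtration, because nonzero
submodules of Hom(E, [1]) are standard (`exists_equiv_Delta_of_ne_bot`). The kernel of a free module
mapping onto M is Hom(E, Y) for some Y (`kerEquivHom`); as Y is a sum of modules [i], this kernel is
a sum of modules P(i), so M has projective dimension at most 1.

Conversely, torsionless modules and Δ-filtered modules are separated because A_n and Δ(i) are; a
module with projective first syzygy is separated because a projective syzygy is recovered from its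
ε-part (`isSeparated_of_projective_ker`).

The Ext condition is matched with projective dimension. T(i + 1) is the cokernel of P(i) in the
injective module P(n), so vanishing of Ext¹(M, T) lets maps from the second syzygy to every P(i)
extend. The second syzygy is itself a sum of modules P(i), so it splits off and the first syzygy is
projective. -/

namespace AuslanderNilpotent

/-! ### Projective dimension and Ext¹ in terms of a first syzygy -/

section Homological

open Abelian

variable {R : Type u} [Ring R] {F M T : Type u} [AddCommGroup F] [Module R F]
  [AddCommGroup M] [Module R M] [AddCommGroup T] [Module R T] [Module.Projective R F]

theorem hasProjectiveDimensionLE_one_iff_projective_ker (π : F →ₗ[R] M)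
    (hπ : Function.Surjective π) :
    HasProjectiveDimensionLE (ModuleCat.of R M) 1 ↔ Module.Projective R (LinearMap.ker π) := by
  have hS := LinearMap.shortExact_shortComplexKer hπ
  have hF : Projective (ModuleCat.of R F) := inferInstance
  rw [IsProjective.iff_projective]
  exact (hS.hasProjectiveDimensionLT_X₃_iff 0 hF).trans
    projective_iff_hasProjectiveDimensionLT_one.symm

/-- Since Ext¹(F, T) = 0, the long exact sequence makes Ext¹(M, T) the cokernel of restriction from
Hom(F, T) to Hom(ker π, T). -/
theorem subsingleton_ext_one_iff_extends (π : F →ₗ[R] M) (hπ : Function.Surjective π) :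
    Subsingleton (Ext (ModuleCat.of R M) (ModuleCat.of R T) 1) ↔
      ∀ g : LinearMap.ker π →ₗ[R] T, ∃ G : F →ₗ[R] T, ∀ x, G x.1 = g x := by
  have hS := LinearMap.shortExact_shortComplexKer hπ
  have hF : Projective (LinearMap.shortComplexKer π).X₂ :=
    inferInstanceAs (Projective (ModuleCat.of R F))
  constructor
  · intro h g
    obtain ⟨y, hy⟩ := Ext.contravariant_sequence_exact₁ hS (ModuleCat.of R T)
      (Ext.mk₀ (ModuleCat.ofHom g)) (add_comm 1 0) (h.elim _ _)
    obtain ⟨G, rfl⟩ := (Ext.mk₀_bijective _ _).2 y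
    rw [Ext.mk₀_comp_mk₀] at hy
    have := (Ext.mk₀_bijective _ _).1 hy
    refine ⟨G.hom, fun x => ?_⟩
    exact congrArg (fun t => t.hom x) this
  · intro h
    refine subsingleton_of_forall_eq 0 fun x => ?_
    obtain ⟨y, rfl⟩ := Ext.contravariant_sequence_exact₃ hS (ModuleCat.of R T) x
      (Ext.eq_zero_of_projective _) (add_comm 1 0)
    obtain ⟨g, rfl⟩ := (Ext.mk₀_bijective _ _).2 y
    obtain ⟨G, hG⟩ := h g.hom
    have hg : g = (LinearMap.shortComplexKer π).f ≫ ModuleCat.ofHom G :=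
      ModuleCat.hom_ext (LinearMap.ext fun x => (hG x).symm)
    rw [hg, ← Ext.mk₀_comp_mk₀, hS.extClass_comp_assoc]

end Homological

/-! ### The functor Hom(E, -) into modules over the opposite endomorphism ring -/

section HomModule

variable {R : Type u} [CommRing R] {E : Type u} [AddCommGroup E] [Module R E]

instance isScalarTower_hom {X : Type*} [AddCommGroup X] [Module R X] :
    IsScalarTower R (Module.End R E)ᵐᵒᵖ (E →ₗ[R] X) where
  smul_assoc r a f := LinearMap.comp_smul f r a.unop

theorem op_smul_apply {X : Type*} [AddCommGroup X] [Module R X] (a : (Module.End R E)ᵐᵒᵖ)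
    (f : E →ₗ[R] X) (e : E) : (a • f) e = f (a.unop e) := rfl

@[simp]
theorem homMap_apply {X Y : Type*} [AddCommGroup X] [Module R X] [AddCommGroup Y] [Module R Y]
    (g : X →ₗ[R] Y) (f : E →ₗ[R] X) (e : E) : homMap E g f e = g (f e) := rfl

theorem homMap_injective {X Y : Type*} [AddCommGroup X] [Module R X] [AddCommGroup Y]
    [Module R Y] {g : X →ₗ[R] Y} (hg : Function.Injective g) :
    Function.Injective (homMap E g) := fun _ _ h =>
  LinearMap.ext fun e => hg (LinearMap.congr_fun h e)

theorem range_homMap_eq_ker {X Y Z : Type*} [AddCommGroup X] [Module R X] [AddCommGroup Y]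
    [Module R Y] [AddCommGroup Z] [Module R Z] {i : X →ₗ[R] Y} {q : Y →ₗ[R] Z}
    (hi : Function.Injective i) (h : LinearMap.range i = LinearMap.ker q) :
    LinearMap.range (homMap E i) = LinearMap.ker (homMap E q) := by
  ext f
  constructor
  · rintro ⟨g, rfl⟩
    refine LinearMap.ext fun e => ?_
    have : i (g e) ∈ LinearMap.ker q := h ▸ ⟨_, rfl⟩
    exact this
  · intro hf
    have hmem : ∀ e, f e ∈ LinearMap.range i := fun e => by
      rw [h]; exact LinearMap.congr_fun hf e
    refine ⟨(LinearEquiv.ofInjective i hi).symm.toLinearMap ∘ₗ f.codRestrict _ hmem, ?_⟩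
    refine LinearMap.ext fun e => ?_
    exact congrArg Subtype.val
      ((LinearEquiv.ofInjective i hi).apply_symm_apply ⟨f e, hmem e⟩)

/-- `Hom(E, -)` applied to an isomorphism. -/
def homCongr {X Y : Type*} [AddCommGroup X] [Module R X] [AddCommGroup Y] [Module R Y]
    (g : X ≃ₗ[R] Y) : (E →ₗ[R] X) ≃ₗ[(Module.End R E)ᵐᵒᵖ] (E →ₗ[R] Y) :=
  LinearEquiv.ofLinearMap (homMap E g.toLinearMap) (homMap E g.symm.toLinearMap)
    (LinearMap.ext fun _ => LinearMap.ext fun _ => g.apply_symm_apply _)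
    (LinearMap.ext fun _ => LinearMap.ext fun _ => g.symm_apply_apply _)

/-- `Hom(E, -)` commutes with products. -/
def homPi {ι : Type*} (X : ι → Type*) [∀ i, AddCommGroup (X i)] [∀ i, Module R (X i)] :
    (E →ₗ[R] ∀ i, X i) ≃ₗ[(Module.End R E)ᵐᵒᵖ] ∀ i, E →ₗ[R] X i where
  toFun f i := LinearMap.proj i ∘ₗ f
  map_add' _ _ := rfl
  map_smul' _ _ := rfl
  invFun f := LinearMap.pi f
  left_inv _ := rfl
  right_inv _ := rfl

variable (R E) in
/-- `Hom(E, E)` is the regular module. -/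
def homSelf : (Module.End R E)ᵐᵒᵖ ≃ₗ[(Module.End R E)ᵐᵒᵖ] (E →ₗ[R] E) where
  toFun a := a.unop
  map_add' _ _ := rfl
  map_smul' _ _ := rfl
  invFun f := MulOpposite.op f
  left_inv _ := rfl
  right_inv _ := rfl

theorem projective_hom_of_retract {X : Type*} [AddCommGroup X] [Module R X] (i : X →ₗ[R] E)
    (q : E →ₗ[R] X) (h : q ∘ₗ i = LinearMap.id) :
    Module.Projective (Module.End R E)ᵐᵒᵖ (E →ₗ[R] X) :=
  Module.Projective.of_split ((homSelf R E).symm.toLinearMap ∘ₗ homMap E i)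
    (homMap E q ∘ₗ (homSelf R E).toLinearMap)
    (LinearMap.ext fun f => LinearMap.ext fun e => LinearMap.congr_fun h (f e))

/-! ### Separated modules and coextension from the summand R of E -/

section Retract

variable (p : E →ₗ[R] R)

/-- The element `y ↦ p(y) e` of `End(E)ᵒᵖ`. -/
def act (e : E) : (Module.End R E)ᵐᵒᵖ := MulOpposite.op (p.smulRight e)

theorem act_add (e e' : E) : act p (e + e') = act p e + act p e' := by
  apply MulOpposite.unop_injective
  refine LinearMap.ext fun y => ?_
  exact smul_add _ _ _

theorem act_smul (r : R) (e : E) : act p (r • e) = r • act p e := by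
  apply MulOpposite.unop_injective
  refine LinearMap.ext fun y => ?_
  exact smul_comm _ _ _

theorem act_mul (e : E) (a : (Module.End R E)ᵐᵒᵖ) : act p e * a = act p (a.unop e) := by
  apply MulOpposite.unop_injective
  refine LinearMap.ext fun y => ?_
  exact map_smul a.unop (p y) e

theorem act_smul_hom {X : Type*} [AddCommGroup X] [Module R X] (e : E) (f : E →ₗ[R] X) :
    act p e • f = p.smulRight (f e) := by
  refine LinearMap.ext fun y => ?_
  exact map_smul f (p y) e

/-- When `p e₀ = 1`, this makes `act p e₀` an idempotent that fixes every `act p e` under left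
multiplication. -/
theorem act_mul_act (e e' : E) : act p e * act p e' = p e • act p e' := by
  rw [act_mul, ← act_smul]; rfl

variable {M : Type*} [AddCommGroup M] [Module (Module.End R E)ᵐᵒᵖ M]

variable (M) in
/-- No nonzero element of `M` generates a submodule annihilated by the idempotent belonging
to the direct summand `R` of `E`. -/
def IsSeparated : Prop := ∀ m : M, (∀ e : E, act p e • m = 0) → m = 0

variable {p} in
theorem IsSeparated.of_injective {N : Type*} [AddCommGroup N] [Module (Module.End R E)ᵐᵒᵖ N]
    (hN : IsSeparated p N) (f : M →ₗ[(Module.End R E)ᵐᵒᵖ] N) (hf : Function.Injective f) :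
    IsSeparated p M := fun m hm =>
  hf <| by rw [map_zero]; exact hN _ fun e => by rw [← map_smul, hm, map_zero]

variable {p} in
theorem IsSeparated.of_extension {N : Submodule (Module.End R E)ᵐᵒᵖ M} (hN : IsSeparated p N)
    (hQ : IsSeparated p (M ⧸ N)) : IsSeparated p M := fun m hm => by
  have hmem : m ∈ N := by
    rw [← Submodule.Quotient.mk_eq_zero]
    exact hQ _ fun e => by rw [← Submodule.Quotient.mk_smul, hm, Submodule.Quotient.mk_zero]
  exact congrArg Subtype.val (hN ⟨m, hmem⟩ fun e => Subtype.ext (hm e))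

theorem isSeparated_pi {ι : Type*} {N : ι → Type*} [∀ i, AddCommGroup (N i)]
    [∀ i, Module (Module.End R E)ᵐᵒᵖ (N i)] (h : ∀ i, IsSeparated p (N i)) :
    IsSeparated p (∀ i, N i) := fun _ hm =>
  funext fun i => h i _ fun e => congrFun (hm e) i

variable [Module R M] [IsScalarTower R (Module.End R E)ᵐᵒᵖ M]

/-- The map `M → Hom(E, X)` induced by an `R`-linear map `φ : M → X`. -/
def coext {X : Type*} [AddCommGroup X] [Module R X] (φ : M →ₗ[R] X) :
    M →ₗ[(Module.End R E)ᵐᵒᵖ] (E →ₗ[R] X) where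
  toFun m :=
    { toFun := fun e => φ (act p e • m)
      map_add' := fun e e' => by rw [act_add, add_smul, map_add]
      map_smul' := fun r e => by rw [act_smul, smul_assoc, map_smul]; rfl }
  map_add' m m' := LinearMap.ext fun e => by
    change φ (_ • (m + m')) = φ _ + φ _
    rw [smul_add, map_add]
  map_smul' a m := LinearMap.ext fun e => by
    change φ (_ • a • m) = φ (_ • m)
    rw [← mul_smul, act_mul]
    rfl

theorem coext_apply {X : Type*} [AddCommGroup X] [Module R X] (φ : M →ₗ[R] X) (m : M) (e : E) :
    coext p φ m e = φ (act p e • m) := rfl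

variable {p} in
theorem IsSeparated.coext_id_injective (h : IsSeparated p M) :
    Function.Injective (coext p (LinearMap.id : M →ₗ[R] M)) :=
  (injective_iff_map_eq_zero _).2 fun m hm => h m fun e => LinearMap.congr_fun hm e

variable {p} {e₀ : E} (hp : p e₀ = 1)
include hp

/-- Evaluating `act p e • f` at `e₀` returns `f e`, so these products determine `f`. -/
theorem isSeparated_hom (X : Type*) [AddCommGroup X] [Module R X] :
    IsSeparated p (E →ₗ[R] X) := fun f hf => LinearMap.ext fun e => by
  simpa [act_smul_hom, hp] using LinearMap.congr_fun (hf e) e₀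

theorem isSeparated_self : IsSeparated p (Module.End R E)ᵐᵒᵖ :=
  (isSeparated_hom hp E).of_injective (homSelf R E).toLinearMap (homSelf R E).injective

omit [Module R M] [IsScalarTower R (Module.End R E)ᵐᵒᵖ M] in
theorem IsTorsionless.isSeparated (h : IsTorsionless (Module.End R E)ᵐᵒᵖ M) :
    IsSeparated p M := fun m hm => h m fun f =>
  isSeparated_self hp _ fun e => by rw [← map_smul, hm, map_zero]

end Retract

/-! ### Injectivity of Hom(E, X), and separation from a projective syzygy -/

section Injective

variable {p : E →ₗ[R] R} {e₀ : E} (hp : p e₀ = 1)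
include hp

theorem injective_hom (X : Type u) [AddCommGroup X] [Module R X] [Module.Injective R X] :
    Module.Injective (Module.End R E)ᵐᵒᵖ (E →ₗ[R] X) where
  out M N _ _ _ _ i hi g := by
    let _ : Module R M := Module.compHom M (algebraMap R (Module.End R E)ᵐᵒᵖ)
    let _ : Module R N := Module.compHom N (algebraMap R (Module.End R E)ᵐᵒᵖ)
    have : IsScalarTower R (Module.End R E)ᵐᵒᵖ M := IsScalarTower.of_algebraMap_smul fun _ _ => rfl
    have : IsScalarTower R (Module.End R E)ᵐᵒᵖ N := IsScalarTower.of_algebraMap_smul fun _ _ => rfl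
    -- By adjunction, `g` corresponds to the R-linear map m ↦ g(m)(e₀). That map extends along `i`,
    -- and `coext` carries the extension back.
    obtain ⟨ψ, hψ⟩ := Module.Injective.out (i.restrictScalars R) hi
      (LinearMap.applyₗ e₀ ∘ₗ g.restrictScalars R)
    refine ⟨coext p ψ, fun m => LinearMap.ext fun e => ?_⟩
    rw [coext_apply, ← map_smul]
    refine (hψ _).trans ?_
    change g (act p e • m) e₀ = _
    rw [map_smul, act_smul_hom, LinearMap.smulRight_apply, hp, one_smul]

variable {s : ℕ}

omit hp in
/-- A retract `K` of a finite free module is determined by its part belonging to the direct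
summand `R` of `E`. -/
theorem exists_eq_act_smul {K : Type*} [AddCommGroup K] [Module (Module.End R E)ᵐᵒᵖ K]
    [Module R K] [IsScalarTower R (Module.End R E)ᵐᵒᵖ K]
    (i : K →ₗ[(Module.End R E)ᵐᵒᵖ] (Fin s → (Module.End R E)ᵐᵒᵖ))
    (q : (Fin s → (Module.End R E)ᵐᵒᵖ) →ₗ[(Module.End R E)ᵐᵒᵖ] K) (h : q ∘ₗ i = LinearMap.id)
    (θ : E →ₗ[R] K) (hθ : ∀ e, act p e₀ • θ e = θ e) : ∃ κ : K, ∀ e, θ e = act p e • κ := by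
  -- Since `θ e` is fixed by `act p e₀`, each coordinate of `i (θ e)` has the form `act p e'`, where
  -- `e'` is that coordinate evaluated at `e₀`. So e ↦ e' is an endomorphism of `E`, that is, an
  -- element of the ring.
  let ev (j : Fin s) : E →ₗ[R] E :=
    { toFun := fun e => (i (θ e) j).unop e₀
      map_add' := fun e e' => by simp
      map_smul' := fun r e => by
        have : i (r • θ e) = r • i (θ e) := (i.restrictScalars R).map_smul r _
        simp [this] }
  refine ⟨q fun j => MulOpposite.op (ev j), fun e => ?_⟩
  have key : act p e • (fun j => MulOpposite.op (ev j)) = i (θ e) := by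
    rw [← hθ e, map_smul]
    funext j
    change act p e * _ = act p e₀ * _
    rw [act_mul, act_mul]
    rfl
  rw [← map_smul, key]
  exact (LinearMap.congr_fun h (θ e)).symm

/-- If every `act p e` kills m, then for a lift f of m all `act p e • f` lie in the kernel.
Projectivity supplies κ in the kernel with the same products, and f = κ because the free module is
separated. Hence m = 0. -/
theorem isSeparated_of_projective_ker {M : Type*} [AddCommGroup M]
    [Module (Module.End R E)ᵐᵒᵖ M]
    (π : (Fin s → (Module.End R E)ᵐᵒᵖ) →ₗ[(Module.End R E)ᵐᵒᵖ] M)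
    (hπ : Function.Surjective π) [Module.Finite (Module.End R E)ᵐᵒᵖ (LinearMap.ker π)]
    [Module.Projective (Module.End R E)ᵐᵒᵖ (LinearMap.ker π)] : IsSeparated p M := by
  intro m hm
  obtain ⟨f, rfl⟩ := hπ m
  obtain ⟨t, q, i, -, -, hqi⟩ := Module.Finite.exists_comp_eq_id_of_projective
    (Module.End R E)ᵐᵒᵖ (LinearMap.ker π)
  let θ : E →ₗ[R] LinearMap.ker π :=
    { toFun := fun e => ⟨act p e • f, by rw [LinearMap.mem_ker, map_smul, hm]⟩
      map_add' := fun e e' => Subtype.ext <| by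
        change act p (e + e') • f = act p e • f + act p e' • f
        rw [act_add, add_smul]
      map_smul' := fun r e => Subtype.ext <| by
        change act p (r • e) • f = r • act p e • f
        rw [act_smul, smul_assoc] }
  obtain ⟨κ, hκ⟩ := exists_eq_act_smul i q hqi θ fun e => Subtype.ext <| by
    change act p e₀ • act p e • f = act p e • f
    rw [← mul_smul, act_mul_act, hp, one_smul]
  have hfκ : f - κ.1 = 0 := isSeparated_pi p (fun _ => isSeparated_self hp) _ fun e => by
    rw [smul_sub, sub_eq_zero]
    exact congrArg Subtype.val (hκ e)
  rw [sub_eq_zero.1 hfκ]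
  exact κ.2

end Injective

/-! ### Syzygies of separated modules -/

section Kernel

variable {p : E →ₗ[R] R} {s : ℕ} {N : Type*} [AddCommGroup N] [Module (Module.End R E)ᵐᵒᵖ N]
  [Module R N] [IsScalarTower R (Module.End R E)ᵐᵒᵖ N]
  (ψ : (Fin s → (Module.End R E)ᵐᵒᵖ) →ₗ[(Module.End R E)ᵐᵒᵖ] N)

variable (p) in
/-- The map `E ^ s → N` obtained from a map of `End(E)ᵒᵖ`-modules by restriction to the parts
belonging to the direct summand `R` of `E`. -/
def restrictAct : (Fin s → E) →ₗ[R] N where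
  toFun v := ψ fun j => act p (v j)
  map_add' v w := by
    rw [← map_add]
    exact congrArg ψ (funext fun j => act_add p _ _)
  map_smul' r v := by
    have : (fun j => act p ((r • v) j)) = r • fun j => act p (v j) :=
      funext fun j => act_smul p _ _
    rw [this]
    exact (ψ.restrictScalars R).map_smul r _

theorem act_smul_map (a : Fin s → (Module.End R E)ᵐᵒᵖ) (e : E) :
    act p e • ψ a = restrictAct p ψ fun j => (a j).unop e := by
  rw [← map_smul]
  exact congrArg ψ (funext fun j => act_mul p _ _)

/-- The kernel of a map from a finite free module to a separated module is of the form
`Hom(E, Y)`. -/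
def kerEquivHom (hN : IsSeparated p N) :
    LinearMap.ker ψ ≃ₗ[(Module.End R E)ᵐᵒᵖ] (E →ₗ[R] LinearMap.ker (restrictAct p ψ)) where
  toFun a := LinearMap.codRestrict _ (LinearMap.pi fun j => (a.1 j).unop) fun e => by
    rw [LinearMap.mem_ker]
    refine (act_smul_map ψ a.1 e).symm.trans ?_
    rw [LinearMap.mem_ker.1 a.2, smul_zero]
  map_add' _ _ := rfl
  map_smul' _ _ := rfl
  invFun f := ⟨fun j => MulOpposite.op (LinearMap.proj j ∘ₗ Submodule.subtype _ ∘ₗ f), by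
    rw [LinearMap.mem_ker]
    -- Separation of `N` reduces `ψ a = 0` to equations indexed by `e`, each of which is membership
    -- of `f e` in the kernel.
    refine hN _ fun e => ?_
    rw [act_smul_map]
    exact (f e).2⟩
  left_inv _ := rfl
  right_inv _ := rfl

end Kernel

end HomModule

/-! ### Arithmetic of Λ_n, its modules [i], and the Auslander algebra -/

noncomputable section Truncated

variable (k : Type u) [Field k] (n : ℕ)

section Lam

theorem mk_X : AdjoinRoot.mk (Polynomial.X ^ n) (Polynomial.X : Polynomial k) = x k n :=
  AdjoinRoot.mk_X

theorem x_pow_self : x k n ^ n = 0 := by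
  rw [← mk_X, ← map_pow, AdjoinRoot.mk_self]

variable {k n}

theorem x_pow_dvd_mk_iff {i : ℕ} (hi : i ≤ n) (f : Polynomial k) :
    x k n ^ i ∣ AdjoinRoot.mk (Polynomial.X ^ n) f ↔ Polynomial.X ^ i ∣ f := by
  rw [← mk_X, ← map_pow]
  refine ⟨?_, map_dvd _⟩
  rintro ⟨g, hg⟩
  obtain ⟨g, rfl⟩ := AdjoinRoot.mk_surjective g
  rw [← map_mul, AdjoinRoot.mk_eq_mk] at hg
  exact (dvd_sub_left (dvd_mul_right _ _)).1 ((pow_dvd_pow _ hi).trans hg)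

theorem x_pow_dvd_of_dvd_mul {i j : ℕ} (hji : j ≤ i) (hi : i ≤ n) {a : Lam k n}
    (h : x k n ^ i ∣ x k n ^ (i - j) * a) : x k n ^ j ∣ a := by
  obtain ⟨f, rfl⟩ := AdjoinRoot.mk_surjective a
  rw [x_pow_dvd_mk_iff (hji.trans hi)]
  rw [← mk_X, ← map_pow _ _ (i - j), ← map_mul, mk_X,
    x_pow_dvd_mk_iff hi] at h
  have hpow : (Polynomial.X : Polynomial k) ^ i = Polynomial.X ^ (i - j) * Polynomial.X ^ j := by
    rw [← pow_add, Nat.sub_add_cancel hji]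
  rw [hpow] at h
  exact (mul_dvd_mul_iff_left (pow_ne_zero _ Polynomial.X_ne_zero)).1 h

theorem isUnit_of_not_x_dvd {a : Lam k n} (h : ¬ x k n ∣ a) : IsUnit a := by
  obtain ⟨f, rfl⟩ := AdjoinRoot.mk_surjective a
  have hf : ¬ Polynomial.X ∣ f := fun hf => h <| by
    rw [← mk_X]; exact map_dvd _ hf
  obtain ⟨u, v, huv⟩ := (((Polynomial.prime_X.irreducible.coprime_iff_not_dvd).2 hf).pow_left
    (m := n))
  refine IsUnit.of_mul_eq_one (AdjoinRoot.mk _ v) ?_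
  rw [mul_comm, ← map_mul, ← map_one (AdjoinRoot.mk _), AdjoinRoot.mk_eq_mk]
  exact ⟨-u, by rw [← huv]; ring⟩

/-- An element not divisible by x is a unit. So if a = x ^ j c lies in I and x does not divide c,
then x ^ j lies in I; this drives the induction on j. -/
theorem x_pow_dvd_of_mem_ideal {I : Ideal (Lam k n)} {i : ℕ} (h : ∀ j < i, x k n ^ j ∉ I)
    {a : Lam k n} (ha : a ∈ I) : x k n ^ i ∣ a := by
  suffices ∀ j ≤ i, x k n ^ j ∣ a from this i le_rfl
  intro j
  induction j with
  | zero => intro _; rw [pow_zero]; exact one_dvd a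
  | succ j ih =>
    intro hj
    obtain ⟨c, rfl⟩ := ih (by omega)
    rw [pow_succ]
    refine mul_dvd_mul_left _ ?_
    by_contra hc
    obtain ⟨u, rfl⟩ := isUnit_of_not_x_dvd hc
    exact h j hj (by simpa using I.mul_mem_right (↑u⁻¹) ha)

instance : Module.Finite k (Lam k n) := (Polynomial.monic_X_pow n).finite_adjoinRoot

instance : IsArtinianRing (Lam k n) := IsArtinianRing.of_finite k _

end Lam

namespace Ind

variable {n}

/-- The projection `Λ_n → [i]`. -/
def mk (i : ℕ) : Lam k n →ₗ[Lam k n] Ind k n i := Submodule.mkQ _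

theorem mk_surjective (i : ℕ) : Function.Surjective (mk k (n := n) i) :=
  Submodule.mkQ_surjective _

variable {k}

theorem mk_eq_zero {i : ℕ} {a : Lam k n} : mk k i a = 0 ↔ x k n ^ i ∣ a :=
  (Submodule.Quotient.mk_eq_zero _).trans Ideal.mem_span_singleton

theorem mk_eq_smul {i : ℕ} (a : Lam k n) : mk k i a = a • mk k i 1 := by
  rw [← map_smul, smul_eq_mul, mul_one]

theorem x_pow_smul {i j : ℕ} (h : i ≤ j) (v : Ind k n i) : x k n ^ j • v = 0 := by
  obtain ⟨a, rfl⟩ := mk_surjective k i v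
  rw [← map_smul, mk_eq_zero]
  exact (pow_dvd_pow _ h).mul_right a

variable {V : Type*} [AddCommGroup V] [Module (Lam k n) V]

/-- The map `[i] → V` sending the generator to `v`. -/
def desc {i : ℕ} (v : V) (h : x k n ^ i • v = 0) : Ind k n i →ₗ[Lam k n] V :=
  Submodule.liftQ _ (LinearMap.toSpanSingleton (Lam k n) V v) <| by
    rw [Ideal.span_le, Set.singleton_subset_iff]
    exact h

@[simp]
theorem desc_mk {i : ℕ} (v : V) (h : x k n ^ i • v = 0) (a : Lam k n) :
    desc v h (mk k i a) = a • v := rfl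

theorem hom_ext {i : ℕ} {f g : Ind k n i →ₗ[Lam k n] V} (h : f (mk k i 1) = g (mk k i 1)) :
    f = g := by
  refine LinearMap.ext fun v => ?_
  obtain ⟨a, rfl⟩ := mk_surjective k i v
  rw [mk_eq_smul, map_smul, map_smul, h]

theorem incl_mk (j i : ℕ) (a : Lam k n) :
    incl k n j i (mk k j a) = mk k i (x k n ^ (i - j) * a) := rfl

theorem incl_injective {j i : ℕ} (hji : j ≤ i) (hi : i ≤ n) :
    Function.Injective (incl k n j i) := by
  refine (injective_iff_map_eq_zero _).2 fun v hv => ?_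
  obtain ⟨a, rfl⟩ := mk_surjective k j v
  rw [incl_mk, mk_eq_zero] at hv
  exact mk_eq_zero.2 (x_pow_dvd_of_dvd_mul hji hi hv)

/-- The projection `[j] → [i]` for `i ≤ j`. -/
def proj {j i : ℕ} (h : i ≤ j) : Ind k n j →ₗ[Lam k n] Ind k n i :=
  desc (mk k i 1) (x_pow_smul h _)

theorem proj_mk {j i : ℕ} (h : i ≤ j) (a : Lam k n) : proj h (mk k j a) = mk k i a := by
  rw [proj, desc_mk, ← mk_eq_smul]

theorem range_incl_eq_ker_proj (i : ℕ) :
    LinearMap.range (incl k n i (i + 1)) = LinearMap.ker (proj (Nat.le_add_left 1 i)) := by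
  ext v
  obtain ⟨a, rfl⟩ := mk_surjective k _ v
  rw [LinearMap.mem_ker, proj_mk, mk_eq_zero, pow_one]
  constructor
  · rintro ⟨w, hw⟩
    obtain ⟨b, rfl⟩ := mk_surjective k _ w
    rw [incl_mk, Nat.add_sub_cancel_left, pow_one, ← sub_eq_zero, ← map_sub, mk_eq_zero] at hw
    exact (dvd_sub_right (dvd_mul_right _ _)).1 ((dvd_pow_self _ (Nat.succ_ne_zero i)).trans hw)
  · rintro ⟨b, rfl⟩
    exact ⟨mk k i b, by rw [incl_mk, Nat.add_sub_cancel_left, pow_one]⟩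

instance (i : ℕ) : Module.Finite (Lam k n) (Ind k n i) :=
  Module.Finite.of_surjective _ (mk_surjective k i)

theorem subsingleton_zero : Subsingleton (Ind k n 0) :=
  subsingleton_of_forall_eq 0 fun v => by
    obtain ⟨a, rfl⟩ := mk_surjective k 0 v
    rw [mk_eq_zero, pow_zero]
    exact one_dvd a

/-- `[n]`, which is isomorphic to `Λ_n`, is an injective module. -/
instance injective_self : Module.Injective (Lam k n) (Ind k n n) := by
  refine Module.Baer.injective fun I g => ?_
  classical
  have hex : ∃ i, x k n ^ i ∈ I := ⟨n, by rw [x_pow_self]; exact I.zero_mem⟩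
  have hin : Nat.find hex ≤ n := Nat.find_min' hex (by rw [x_pow_self]; exact I.zero_mem)
  set i := Nat.find hex with hi
  have hxi : x k n ^ i ∈ I := Nat.find_spec hex
  obtain ⟨b, hb⟩ := mk_surjective k n (g ⟨x k n ^ i, hxi⟩)
  -- The ideal is generated by x ^ i. Since x ^ (n - i) kills x ^ i, it kills the image of x ^ i, so
  -- a representative `b` of that image is divisible by x ^ i. The quotient `c` defines the
  -- extension.
  have hdvd : x k n ^ i ∣ b := by
    refine x_pow_dvd_of_dvd_mul hin le_rfl ?_
    rw [← mk_eq_zero, ← smul_eq_mul, map_smul, hb, ← map_smul]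
    convert map_zero g
    refine Subtype.ext ?_
    change x k n ^ (n - i) * x k n ^ i = 0
    rw [← pow_add, Nat.sub_add_cancel hin, x_pow_self]
  obtain ⟨c, rfl⟩ := hdvd
  refine ⟨LinearMap.toSpanSingleton _ _ (mk k n c), fun a ha => ?_⟩
  obtain ⟨d, rfl⟩ := x_pow_dvd_of_mem_ideal (i := i) (fun j hj => Nat.find_min hex hj) ha
  have : (⟨x k n ^ i * d, ha⟩ : I) = d • ⟨x k n ^ i, hxi⟩ := Subtype.ext (mul_comm _ _)
  rw [this, map_smul, ← hb, LinearMap.toSpanSingleton_apply, ← map_smul, ← map_smul,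
    smul_eq_mul, smul_eq_mul]
  congr 1
  ring

end Ind

section Structure

variable {k n}

/-- Every finitely generated `Λ_n`-module is a direct sum of modules `[i]`. -/
theorem exists_equiv_pi_ind (V : Type u) [AddCommGroup V] [Module (Lam k n) V]
    [Module.Finite (Lam k n) V] :
    ∃ (s : ℕ) (i : Fin s → ℕ), (∀ t, i t ≤ n) ∧
      Nonempty (V ≃ₗ[Lam k n] ∀ t, Ind k n (i t)) := by
  -- The decomposition is that of a finitely generated X-power torsion module over k[X]. The
  -- exponents are at most n because X ^ n kills V, and the resulting isomorphism is Λ_n-linear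
  -- since k[X] maps onto Λ_n.
  let φ := AdjoinRoot.mk ((Polynomial.X : Polynomial k) ^ n)
  let _ : Algebra (Polynomial k) (Lam k n) := φ.toAlgebra
  let _ : Module (Polynomial k) V := Module.compHom V φ
  let _ (i : ℕ) : Module (Polynomial k) (Ind k n i) := Module.compHom _ φ
  have : IsScalarTower (Polynomial k) (Lam k n) V :=
    IsScalarTower.of_algebraMap_smul fun _ _ => rfl
  have : Module.Finite (Polynomial k) (Lam k n) :=
    Module.Finite.of_surjective (Algebra.linearMap _ _) AdjoinRoot.mk_surjective
  have : Module.Finite (Polynomial k) V := Module.Finite.trans (Lam k n) V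
  have hkill : ∀ v : V, (Polynomial.X : Polynomial k) ^ n • v = 0 := fun v => by
    change φ (Polynomial.X ^ n) • v = 0
    rw [AdjoinRoot.mk_self, zero_smul]
  obtain ⟨s, i, ⟨e⟩⟩ := Module.torsion_by_prime_power_decomposition (R := Polynomial k) (M := V)
    Polynomial.prime_X.irreducible
    ((Submodule.isTorsion'_powers_iff _).2 fun v => ⟨n, hkill v⟩)
  have hi : ∀ t, i t ≤ n := fun t => by
    have h := hkill (e.symm (DirectSum.lof (Polynomial k) _ _ t (Submodule.Quotient.mk 1)))
    rw [← map_smul, ← map_smul, LinearEquiv.map_eq_zero_iff] at h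
    replace h := congrArg (DirectSum.component (Polynomial k) _ _ t) h
    rw [DirectSum.component.lof_self, map_zero, ← Submodule.Quotient.mk_smul,
      Submodule.Quotient.mk_eq_zero, smul_eq_mul, mul_one, Ideal.submodule_span_eq,
      Ideal.mem_span_singleton] at h
    exact (pow_dvd_pow_iff Polynomial.X_ne_zero Polynomial.not_isUnit_X).1 h
  have equiv : ∀ t, Nonempty ((Polynomial k ⧸
      Submodule.span (Polynomial k) {(Polynomial.X : Polynomial k) ^ i t}) ≃ₗ[Polynomial k]
      Ind k n (i t)) := fun t => by
    let q : Polynomial k →ₗ[Polynomial k] Ind k n (i t) :=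
      { toFun := fun f => Ind.mk k (i t) (φ f)
        map_add' := fun f g => by rw [map_add, map_add]
        map_smul' := fun f g => by
          rw [smul_eq_mul, map_mul, ← smul_eq_mul, map_smul]
          rfl }
    have hq : Function.Surjective q := (Ind.mk_surjective k _).comp AdjoinRoot.mk_surjective
    refine ⟨(Submodule.quotEquivOfEq _ _ ?_).trans (q.quotKerEquivOfSurjective hq)⟩
    ext f
    rw [LinearMap.mem_ker, Ideal.submodule_span_eq, Ideal.mem_span_singleton]
    exact (x_pow_dvd_mk_iff (hi t) f).symm.trans Ind.mk_eq_zero.symm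
  refine ⟨s, i, hi, ⟨?_⟩⟩
  let e' := (e.trans (DirectSum.linearEquivFunOnFintype _ _ _)).trans
    (LinearEquiv.piCongrRight fun t => (equiv t).some)
  exact
    { e' with
      map_smul' := fun r v => by
        obtain ⟨f, rfl⟩ := AdjoinRoot.mk_surjective r
        exact e'.map_smul f v }

end Structure

section Generator

/-- The inclusion of a direct summand of `E`. -/
def single (j : Fin n) : Ind k n (j + 1) →ₗ[Lam k n] E k n :=
  LinearMap.single (Lam k n) (fun j : Fin n => Ind k n (j + 1)) j

/-- The projection onto a direct summand of `E`. -/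
def component (j : Fin n) : E k n →ₗ[Lam k n] Ind k n (j + 1) :=
  LinearMap.proj (φ := fun j : Fin n => Ind k n (j + 1)) j

theorem component_comp_single (j : Fin n) : component k n j ∘ₗ single k n j = LinearMap.id :=
  LinearMap.proj_comp_single_same _ _ j

variable {k n}

theorem E_hom_ext {V : Type*} [AddCommGroup V] [Module (Lam k n) V]
    {f g : E k n →ₗ[Lam k n] V} (h : ∀ j, f (single k n j (Ind.mk k _ 1)) =
      g (single k n j (Ind.mk k _ 1))) : f = g :=
  LinearMap.pi_ext' (φ := fun j : Fin n => Ind k n (j + 1)) fun j =>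
    Ind.hom_ext (f := f ∘ₗ single k n j) (g := g ∘ₗ single k n j) (h j)

instance : Module.Finite (Lam k n) (E k n) :=
  inferInstanceAs (Module.Finite (Lam k n) ((j : Fin n) → Ind k n (j + 1)))

instance : Module.Finite (Lam k n) (A k n) := by
  let ev : A k n →ₗ[Lam k n] (Fin n → E k n) :=
    { toFun := fun a j => a.unop (single k n j (Ind.mk k _ 1))
      map_add' := fun _ _ => rfl
      map_smul' := fun _ _ => rfl }
  exact Module.Finite.of_injective ev fun a b h =>
    MulOpposite.unop_injective (E_hom_ext fun j => congrFun h j)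

instance : IsNoetherianRing (A k n) :=
  isNoetherianRing_iff.2 (isNoetherian_of_tower (Lam k n) inferInstance)

variable (k n) in
theorem exists_generator : ∃ (p : E k n →ₗ[Lam k n] Lam k n) (e₀ : E k n), p e₀ = 1 := by
  cases n with
  | zero =>
    -- For n = 0 the ring Λ_n is zero, so 1 = 0.
    refine ⟨0, 0, ?_⟩
    rw [map_zero, ← x_pow_self k 0, pow_zero]
  | succ m =>
    have hx : x k (m + 1) ^ ((Fin.last m : ℕ) + 1) • (1 : Lam k (m + 1)) = 0 := by
      rw [Fin.val_last, x_pow_self, zero_smul]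
    refine ⟨Ind.desc 1 hx ∘ₗ component k (m + 1) (Fin.last m),
      single k (m + 1) (Fin.last m) (Ind.mk k _ 1), ?_⟩
    change Ind.desc 1 hx ((component k (m + 1) (Fin.last m) ∘ₗ single k (m + 1) (Fin.last m)) _) = _
    rw [component_comp_single]
    exact (Ind.desc_mk _ _ _).trans (one_smul _ _)

theorem projective_P {i : ℕ} (hi : i ≤ n) : Module.Projective (A k n) (P k n i) := by
  cases i with
  | zero =>
    have : Subsingleton (Ind k n 0) := Ind.subsingleton_zero
    have : Subsingleton (P k n 0) := ⟨fun f g => LinearMap.ext fun e => Subsingleton.elim _ _⟩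
    infer_instance
  | succ j => exact projective_hom_of_retract _ _ (component_comp_single k n ⟨j, hi⟩)

theorem exists_hom_equiv_pi_P (Y : Type u) [AddCommGroup Y] [Module (Lam k n) Y]
    [Module.Finite (Lam k n) Y] : ∃ (s : ℕ) (i : Fin s → ℕ), (∀ t, i t ≤ n) ∧
      Nonempty ((E k n →ₗ[Lam k n] Y) ≃ₗ[A k n] ∀ t, P k n (i t)) := by
  obtain ⟨s, i, hi, ⟨e⟩⟩ := exists_equiv_pi_ind (k := k) (n := n) Y
  exact ⟨s, i, hi, ⟨(homCongr e).trans (homPi _)⟩⟩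

theorem injective_P_self : Module.Injective (A k n) (P k n n) := by
  obtain ⟨p, e₀, hp⟩ := exists_generator k n
  exact injective_hom hp _

end Generator

end Truncated

/-! ### Splitting syzygies and shifting along cosyzygies -/

section Splitting

theorem projective_pi {R ι : Type*} [Ring R] [Finite ι] (M : ι → Type*)
    [∀ i, AddCommGroup (M i)] [∀ i, Module R (M i)] [∀ i, Module.Projective R (M i)] :
    Module.Projective R (∀ i, M i) := by
  classical
  cases nonempty_fintype ι
  exact Module.Projective.of_equiv (DirectSum.linearEquivFunOnFintype R ι M)

variable {S : Type u} [Ring S] {F K F' : Type u} [AddCommGroup F] [Module S F] [AddCommGroup K]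
  [Module S K] [AddCommGroup F'] [Module S F']

theorem exists_comp_eq_of_ker_le {X : Type*} [AddCommGroup X] [Module S X] {ρ : F' →ₗ[S] K}
    (hρ : Function.Surjective ρ) (g : F' →ₗ[S] X) (h : LinearMap.ker ρ ≤ LinearMap.ker g) :
    ∃ c : K →ₗ[S] X, ∀ y, c (ρ y) = g y := by
  refine ⟨(LinearMap.ker ρ).liftQ g h ∘ₗ (ρ.quotKerEquivOfSurjective hρ).symm.toLinearMap,
    fun y => ?_⟩
  have : (ρ.quotKerEquivOfSurjective hρ).symm (ρ y) = Submodule.Quotient.mk y := by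
    rw [LinearEquiv.symm_apply_eq]
    rfl
  change (LinearMap.ker ρ).liftQ g h ((ρ.quotKerEquivOfSurjective hρ).symm (ρ y)) = g y
  rw [this]
  rfl

/-- The endomorphism 1 - h of F' vanishes on ker ρ, so it factors through ρ and gives a section of
ρ. -/
theorem projective_of_retraction_ker [Module.Projective S F'] {ρ : F' →ₗ[S] K}
    (hρ : Function.Surjective ρ) (h : F' →ₗ[S] LinearMap.ker ρ) (hh : ∀ y, h y.1 = y) :
    Module.Projective S K := by
  obtain ⟨σ, hσ⟩ := exists_comp_eq_of_ker_le hρ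
    (LinearMap.id - (LinearMap.ker ρ).subtype ∘ₗ h) fun y hy => by
      have := congrArg Subtype.val (hh ⟨y, hy⟩)
      exact sub_eq_zero.2 this.symm
  refine Module.Projective.of_split σ ρ (LinearMap.ext fun z => ?_)
  obtain ⟨y, rfl⟩ := hρ z
  change ρ (σ (ρ y)) = ρ y
  rw [hσ]
  change ρ (y - (h y).1) = ρ y
  rw [map_sub, LinearMap.mem_ker.1 (h y).2, sub_zero]

/-- If `Ext¹` of `F / K` with values in the cosyzygy `C` of `P` vanishes, then maps from the
second syzygy of `F / K` to `P` extend. -/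
theorem exists_extension_of_cosyzygy {P I C : Type u} [AddCommGroup P] [Module S P]
    [AddCommGroup I] [Module S I] [AddCommGroup C] [Module S C] [Module.Projective S F]
    [Module.Injective S I] {i : K →ₗ[S] F} {ρ : F' →ₗ[S] K} (hρ : Function.Surjective ρ)
    {a : P →ₗ[S] I} (ha : Function.Injective a) {b : I →ₗ[S] C} (hb : Function.Surjective b)
    (hab : LinearMap.range a = LinearMap.ker b)
    (hext : ∀ c : K →ₗ[S] C, ∃ c' : F →ₗ[S] C, ∀ y, c' (i y) = c y)
    (g : LinearMap.ker ρ →ₗ[S] P) : ∃ h : F' →ₗ[S] P, ∀ y, h y.1 = g y := by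
  obtain ⟨g', hg'⟩ := Module.Injective.out (LinearMap.ker ρ).subtype
    (LinearMap.ker ρ).injective_subtype (a ∘ₗ g)
  -- On ker ρ the extension `g'` takes values in the image of P, so `b ∘ g'` descends to K.
  obtain ⟨c, hc⟩ := exists_comp_eq_of_ker_le hρ (b ∘ₗ g') fun y hy => by
    change b (g' y) = 0
    rw [show g' y = a (g ⟨y, hy⟩) from hg' ⟨y, hy⟩, ← LinearMap.mem_ker, ← hab]
    exact ⟨_, rfl⟩
  obtain ⟨c', hc'⟩ := hext c
  obtain ⟨d, hd⟩ := Module.projective_lifting_property b c' hb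
  -- The correction d ∘ i ∘ ρ cancels `b ∘ g'`, so `w` lands in the image of P; it vanishes on ker
  -- ρ, so `w` still restricts to `g` there.
  let w : F' →ₗ[S] I := g' - d ∘ₗ i ∘ₗ ρ
  have hw : ∀ y, w y ∈ LinearMap.range a := fun y => by
    rw [hab, LinearMap.mem_ker]
    change b (g' y - d (i (ρ y))) = 0
    rw [map_sub, sub_eq_zero, show b (d (i (ρ y))) = c' (i (ρ y)) from LinearMap.congr_fun hd _,
      hc', hc]
    rfl
  refine ⟨(LinearEquiv.ofInjective a ha).symm.toLinearMap ∘ₗ w.codRestrict _ hw, fun y => ha ?_⟩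
  have h1 : a ((LinearEquiv.ofInjective a ha).symm ⟨w y.1, hw y.1⟩) = w y.1 :=
    congrArg Subtype.val ((LinearEquiv.ofInjective a ha).apply_symm_apply ⟨w y.1, hw y.1⟩)
  refine h1.trans ?_
  change g' y.1 - d (i (ρ y.1)) = a (g y)
  rw [LinearMap.mem_ker.1 y.2, map_zero, map_zero, sub_zero]
  exact hg' y

end Splitting

noncomputable section Truncated

variable {k : Type u} [Field k] {n : ℕ}

theorem range_homMap_eq_ker_mkQ (j i : ℕ) :
    LinearMap.range (homMap (E k n) (incl k n j i)) = LinearMap.ker (PSub k n j i).mkQ :=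
  (Submodule.ker_mkQ _).symm

/-! ### Vanishing of Ext¹(M, T) and projectivity of the first syzygy -/

section ExtTilting

variable {r : ℕ} {M : Type u} [AddCommGroup M] [Module (A k n) M]
  {π : (Fin r → A k n) →ₗ[A k n] M}

/-- Each T(j) is a quotient of the injective module P(n): a map from the projective kernel lifts to
P(n), extends there, and is projected back. -/
theorem extends_of_projective_ker [Module.Projective (A k n) (LinearMap.ker π)]
    (g : LinearMap.ker π →ₗ[A k n] T k n) :
    ∃ G : (Fin r → A k n) →ₗ[A k n] T k n, ∀ y, G y.1 = g y := by
  have := injective_P_self (k := k) (n := n)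
  have h : ∀ j : Fin n, ∃ G : (Fin r → A k n) →ₗ[A k n] TSummand k n j, ∀ y, G y.1 = g y j := by
    intro j
    obtain ⟨l, hl⟩ := Module.projective_lifting_property (PSub k n j n).mkQ (LinearMap.proj j ∘ₗ g)
      (Submodule.mkQ_surjective _)
    obtain ⟨G, hG⟩ := Module.Injective.out (LinearMap.ker π).subtype
      (LinearMap.ker π).injective_subtype l
    refine ⟨(PSub k n j n).mkQ ∘ₗ G, fun y => ?_⟩
    exact (congrArg _ (hG y)).trans (LinearMap.congr_fun hl y)
  choose G hG using h
  exact ⟨LinearMap.pi G, fun y => funext fun j => hG j y⟩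

/-- The first syzygy is separated, as a submodule of a free module, so the second is a sum of
modules P(i). Its coordinate maps extend to the covering free module and assemble to a retraction.
-/
theorem projective_ker_of_extends
    (h : ∀ g : LinearMap.ker π →ₗ[A k n] T k n,
      ∃ G : (Fin r → A k n) →ₗ[A k n] T k n, ∀ y, G y.1 = g y) :
    Module.Projective (A k n) (LinearMap.ker π) := by
  obtain ⟨p, e₀, hp⟩ := exists_generator k n
  have hsep : IsSeparated p (LinearMap.ker π) :=
    (isSeparated_pi p fun _ => isSeparated_self hp).of_injective (LinearMap.ker π).subtype
      (LinearMap.ker π).injective_subtype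
  obtain ⟨s, ρ, hρ⟩ := Module.Finite.exists_fin' (A k n) (LinearMap.ker π)
  obtain ⟨t, i, hi, ⟨e⟩⟩ := exists_hom_equiv_pi_P (k := k) (n := n) (LinearMap.ker (restrictAct p ρ))
  let e' := (kerEquivHom ρ hsep).trans e
  have := injective_P_self (k := k) (n := n)
  have hcomp : ∀ l : Fin t, ∃ g : (Fin s → A k n) →ₗ[A k n] P k n (i l), ∀ y, g y.1 = e' y l := by
    intro l
    obtain hl | hl := (hi l).lt_or_eq
    · refine exists_extension_of_cosyzygy (i := (LinearMap.ker π).subtype) hρ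
        (homMap_injective (Ind.incl_injective hl.le le_rfl)) (Submodule.mkQ_surjective _)
        (range_homMap_eq_ker_mkQ (i l) n) (fun c => ?_) (LinearMap.proj l ∘ₗ e'.toLinearMap)
      -- With indices starting at 0, `TSummand k n j` is P(n) / P(i l), the cosyzygy of P(i l). For
      -- i l = n no such summand is needed, since P(n) is injective.
      let j : Fin n := ⟨i l, hl⟩
      obtain ⟨G, hG⟩ := h (LinearMap.single (A k n) (TSummand k n) j ∘ₗ c)
      refine ⟨LinearMap.proj j ∘ₗ G, fun y => ?_⟩
      refine (congrFun (hG y) j).trans ?_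
      exact Pi.single_eq_same (M := TSummand k n) j (c y)
    · have : Module.Injective (A k n) (P k n (i l)) := by rwa [hl]
      exact Module.Injective.out (LinearMap.ker ρ).subtype (LinearMap.ker ρ).injective_subtype
        (LinearMap.proj l ∘ₗ e'.toLinearMap)
  choose g hg using hcomp
  refine projective_of_retraction_ker hρ (e'.symm.toLinearMap ∘ₗ LinearMap.pi g) fun y => ?_
  change e'.symm (fun l => g l y.1) = y
  rw [LinearEquiv.symm_apply_eq]
  exact funext fun l => hg l y

theorem projective_ker_of_isSeparated {p : E k n →ₗ[Lam k n] Lam k n} (hM : IsSeparated p M)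
    [Module.Finite (A k n) M] : Module.Projective (A k n) (LinearMap.ker π) := by
  let _ : Module (Lam k n) M := Module.compHom M (algebraMap (Lam k n) (A k n))
  have : IsScalarTower (Lam k n) (A k n) M := IsScalarTower.of_algebraMap_smul fun _ _ => rfl
  obtain ⟨t, i, hi, ⟨e⟩⟩ := exists_hom_equiv_pi_P (k := k) (n := n) (LinearMap.ker (restrictAct p π))
  have : ∀ l, Module.Projective (A k n) (P k n (i l)) := fun l => projective_P (hi l)
  have := projective_pi (R := A k n) fun l => P k n (i l)
  exact Module.Projective.of_equiv ((kerEquivHom π hM).trans e).symm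

end ExtTilting

/-! ### Projective injective envelopes -/

section Envelope

/-- Every finitely generated `Λ_n`-module is essential in a finite direct sum of copies of
`[n]`. -/
theorem exists_essential_embedding (V : Type u) [AddCommGroup V] [Module (Lam k n) V]
    [Module.Finite (Lam k n) V] :
    ∃ (ι : Type) (_ : Finite ι) (j : V →ₗ[Lam k n] (ι → Ind k n n)), Function.Injective j ∧
      ∀ q ≠ 0, ∃ (r : Lam k n) (v : V), v ≠ 0 ∧ r • q = j v := by
  classical
  obtain ⟨s, i, hi, ⟨e⟩⟩ := exists_equiv_pi_ind (k := k) (n := n) V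
  -- Zero summands [0] are dropped: a copy of [n] over one of them would spoil essentiality.
  let j : V →ₗ[Lam k n] ({t // i t ≠ 0} → Ind k n n) :=
    LinearMap.pi fun t => incl k n (i t) n ∘ₗ LinearMap.proj t.1 ∘ₗ e.toLinearMap
  refine ⟨{t // i t ≠ 0}, inferInstance, j, ?_, fun q hq => ?_⟩
  · refine (injective_iff_map_eq_zero _).2 fun v hv => ?_
    rw [← e.map_eq_zero_iff]
    funext t
    by_cases ht : i t = 0
    · have : Subsingleton (Ind k n (i t)) := by rw [ht]; exact Ind.subsingleton_zero
      exact Subsingleton.elim _ _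
    · exact Ind.incl_injective (hi t) le_rfl ((congrFun hv ⟨t, ht⟩).trans (map_zero _).symm)
  · have hex : ∃ m, x k n ^ m • q = 0 := ⟨n, funext fun t => Ind.x_pow_smul le_rfl (q t)⟩
    -- The last nonzero multiple x ^ m q is killed by x, so its coordinates are multiples of x ^ (n
    -- - 1). Each therefore lies in the image of [i t], as i t ≥ 1.
    obtain ⟨m, hm⟩ : ∃ m, Nat.find hex = m + 1 := Nat.exists_eq_succ_of_ne_zero fun h0 => hq <| by
      simpa [h0] using Nat.find_spec hex
    have hne : x k n ^ m • q ≠ 0 := Nat.find_min hex (by omega)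
    have hzero : x k n ^ (m + 1) • q = 0 := hm ▸ Nat.find_spec hex
    have hw : ∀ t, ∃ w : Ind k n (i t), i t ≠ 0 →
        ∀ ht : i t ≠ 0, incl k n (i t) n w = (x k n ^ m • q) ⟨t, ht⟩ := by
      intro t
      by_cases ht : i t = 0
      · exact ⟨0, fun h => absurd ht h⟩
      obtain ⟨a, ha⟩ := Ind.mk_surjective k n ((x k n ^ m • q) ⟨t, ht⟩)
      have hit := hi t
      have hxa : x k n ^ n ∣ x k n ^ (n - (n - 1)) * a := by
        rw [show n - (n - 1) = 1 by omega, pow_one, ← Ind.mk_eq_zero, ← smul_eq_mul, map_smul, ha]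
        rw [pow_succ', mul_smul] at hzero
        exact congrFun hzero ⟨t, ht⟩
      obtain ⟨b, rfl⟩ := x_pow_dvd_of_dvd_mul (Nat.sub_le n 1) le_rfl hxa
      refine ⟨Ind.mk k _ (x k n ^ (i t - 1) * b), fun _ _ => ?_⟩
      rw [Ind.incl_mk, ← mul_assoc, ← pow_add, ← ha]
      congr 3
      omega
    choose w hw using hw
    have hj : x k n ^ m • q = j (e.symm w) := funext fun t => by
      change _ = incl k n (i t) n (e (e.symm w) t)
      rw [e.apply_symm_apply]
      exact (hw t t.2 t.2).symm
    refine ⟨_, e.symm w, fun h0 => hne ?_, hj⟩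
    rw [hj, h0, map_zero]

theorem exists_injectiveEnvelope_projective {p : E k n →ₗ[Lam k n] Lam k n} {e₀ : E k n}
    (hp : p e₀ = 1) {M : Type u} [AddCommGroup M] [Module (A k n) M] [Module.Finite (A k n) M]
    (hM : IsSeparated p M) :
    ∃ (I : Type u) (_ : AddCommGroup I) (_ : Module (A k n) I) (ι : M →ₗ[A k n] I),
      IsInjectiveEnvelope ι ∧ Module.Projective (A k n) I := by
  let _ : Module (Lam k n) M := Module.compHom M (algebraMap (Lam k n) (A k n))
  have : IsScalarTower (Lam k n) (A k n) M := IsScalarTower.of_algebraMap_smul fun _ _ => rfl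
  have : Module.Finite (Lam k n) M := Module.Finite.trans (A k n) M
  -- The range of `τ` is the ε-part of M.
  let τ : M →ₗ[Lam k n] M := DistribSMul.toLinearMap (Lam k n) M (act p e₀)
  have hτ : ∀ e m, τ (act p e • m) = act p e • m := fun e m => by
    change act p e₀ • act p e • m = _
    rw [← mul_smul, act_mul_act, hp, one_smul]
  obtain ⟨ι, _, j, hj, hess⟩ := exists_essential_embedding (k := k) (n := n) (LinearMap.range τ)
  have hι : ∀ m e, coext p (j ∘ₗ τ.rangeRestrict) m e = j ⟨act p e • m, ⟨_, hτ e m⟩⟩ :=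
    fun m e => congrArg j (Subtype.ext (hτ e m))
  refine ⟨E k n →ₗ[Lam k n] (ι → Ind k n n), inferInstance, inferInstance,
    coext p (j ∘ₗ τ.rangeRestrict), ⟨injective_hom hp _, ?_, fun N hN => ?_⟩, ?_⟩
  · refine (injective_iff_map_eq_zero _).2 fun m hm => hM m fun e => ?_
    have := LinearMap.congr_fun hm e
    rw [hι] at this
    exact congrArg Subtype.val (hj (this.trans (map_zero j).symm))
  · refine (Submodule.eq_bot_iff _).2 fun f hf => ?_
    by_contra hf0
    obtain ⟨e, he⟩ : ∃ e, f e ≠ 0 := by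
      by_contra! h
      exact hf0 (LinearMap.ext h)
    obtain ⟨r, ⟨_, m, rfl⟩, hv, hr⟩ := hess (f e) he
    -- A nonzero value `f e` has a multiple `j v` with v ≠ 0. Acting on `f` by `act p (r • e)` then
    -- gives the image of v, a nonzero common element of `N` and the range.
    have hmem : act p (r • e) • f ∈ N ⊓ LinearMap.range (coext p (j ∘ₗ τ.rangeRestrict)) := by
      refine ⟨N.smul_mem _ hf, τ m, LinearMap.ext fun e' => ?_⟩
      rw [hι, act_smul_hom, LinearMap.smulRight_apply, map_smul, hr]
      refine Eq.trans (congrArg j ?_) (j.map_smul (p e') _)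
      refine Subtype.ext ?_
      change act p e' • act p e₀ • m = p e' • act p e₀ • m
      rw [← mul_smul, act_mul_act, smul_assoc]
    rw [hN, Submodule.mem_bot] at hmem
    have h0 := LinearMap.congr_fun hmem e₀
    rw [act_smul_hom, LinearMap.smulRight_apply, hp, one_smul, map_smul, hr] at h0
    exact hv (hj (h0.trans (map_zero j).symm))
  · have := projective_P (k := k) (n := n) le_rfl
    have := projective_pi (R := A k n) fun _ : ι => P k n n
    exact Module.Projective.of_equiv (homPi fun _ : ι => Ind k n n).symm

theorem isTorsionless_of_injective {R M I : Type*} [Ring R] [AddCommGroup M] [Module R M]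
    [AddCommGroup I] [Module R I] [Module.Projective R I] (ι : M →ₗ[R] I)
    (hι : Function.Injective ι) : IsTorsionless R M := fun m hm => by
  obtain ⟨s, hs⟩ := Module.projective_def'.1 ‹Module.Projective R I›
  refine hι ((LinearMap.injective_of_comp_eq_id s _ hs) ?_)
  rw [map_zero, map_zero]
  exact Finsupp.ext fun y => hm (Finsupp.lapply y ∘ₗ s ∘ₗ ι)

end Envelope

end Truncated

/-! ### Δ-filtrations -/

noncomputable section Filtration

variable {k : Type u} [Field k] {n : ℕ}

theorem HasDeltaFiltration.of_subsingleton (M : Type u) [AddCommGroup M] [Module (A k n) M]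
    [Subsingleton M] : HasDeltaFiltration k n M :=
  ⟨0, fun _ => ⊥, monotone_const, rfl, Subsingleton.elim _ _, fun _ h => absurd h (Nat.not_lt_zero _)⟩

theorem HasDeltaFiltration.of_extension {M' M : Type u} [AddCommGroup M'] [Module (A k n) M']
    [AddCommGroup M] [Module (A k n) M] (ι : M' →ₗ[A k n] M) (hι : Function.Injective ι)
    (h : HasDeltaFiltration k n M') (hq : LinearMap.range ι = ⊤ ∨
      ∃ i, Nonempty ((M ⧸ LinearMap.range ι) ≃ₗ[A k n] Delta k n i)) :
    HasDeltaFiltration k n M := by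
  obtain ⟨m, F, hmono, h0, hm, hF⟩ := h
  have hquot : ∀ j < m, ∃ i : Fin n, Nonempty (((F (j + 1)).map ι ⧸
      ((F j).map ι).submoduleOf ((F (j + 1)).map ι)) ≃ₗ[A k n] Delta k n i) := fun j hj => by
    obtain ⟨i, ⟨e⟩⟩ := hF j hj
    refine ⟨i, ⟨(Submodule.Quotient.equiv _ _
      (Submodule.equivMapOfInjective ι hι (F (j + 1))) ?_).symm.trans e⟩⟩
    ext ⟨_, y, hy, rfl⟩
    constructor
    · rintro ⟨z, hz, hzy⟩
      exact ⟨z.1, hz, congrArg Subtype.val hzy⟩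
    · rintro ⟨z, hz, hzy⟩
      have hzy' : z = y := hι hzy
      subst hzy'
      exact ⟨⟨z, hy⟩, hz, rfl⟩
  rcases hq with htop | ⟨i, ⟨e⟩⟩
  · refine ⟨m, fun j => (F j).map ι, fun a b hab => Submodule.map_mono (hmono hab), ?_, ?_, hquot⟩
    · change (F 0).map ι = ⊥
      rw [h0, Submodule.map_bot]
    · change (F m).map ι = ⊤
      rw [hm, Submodule.map_top, htop]
  · let G : ℕ → Submodule (A k n) M := fun j => if j ≤ m then (F j).map ι else ⊤
    have hG : ∀ j ≤ m, G j = (F j).map ι := fun j hj => if_pos hj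
    have hG' : G (m + 1) = ⊤ := if_neg (by omega)
    refine ⟨m + 1, G, fun a b hab => ?_, ?_, hG', fun j hj => ?_⟩
    · by_cases hb : b ≤ m
      · rw [hG a (hab.trans hb), hG b hb]
        exact Submodule.map_mono (hmono hab)
      · rw [show G b = ⊤ from if_neg hb]
        exact le_top
    · rw [hG 0 (Nat.zero_le m), h0, Submodule.map_bot]
    · obtain hj | rfl := (Nat.lt_succ_iff.1 hj).lt_or_eq
      · rw [hG j hj.le, hG (j + 1) hj]
        exact hquot j hj
      · rw [hG j le_rfl, hG', hm, Submodule.map_top]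
        refine ⟨i, ⟨(Submodule.Quotient.equiv _ _ Submodule.topEquiv ?_).trans e⟩⟩
        ext y
        constructor
        · rintro ⟨z, hz, rfl⟩
          exact hz
        · intro hy
          exact ⟨⟨y, trivial⟩, hy, rfl⟩

/-- `Δ(j + 1)` is isomorphic to the image of `P(j + 1)` in `Hom(E, [1])`. -/
def deltaEquivRange (j : Fin n) : Delta k n j ≃ₗ[A k n]
    LinearMap.range (homMap (E k n) (Ind.proj (k := k) (n := n) (Nat.le_add_left 1 (j : ℕ)))) :=
  (Submodule.quotEquivOfEq _ _ (range_homMap_eq_ker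
    (Ind.incl_injective (Nat.le_succ _) j.2) (Ind.range_incl_eq_ker_proj _))).trans
    (LinearMap.quotKerEquivRange _)

/-- Every nonzero submodule of `Hom(E, [1])` is isomorphic to a standard module. -/
theorem exists_equiv_Delta_of_ne_bot (N : Submodule (A k n) (P k n 1)) (hN : N ≠ ⊥) :
    ∃ j : Fin n, Nonempty (N ≃ₗ[A k n] Delta k n j) := by
  let U : Set (Fin n) := {j | ∃ φ ∈ N, φ (single k n j (Ind.mk k _ 1)) ≠ 0}
  have hU : U.Nonempty := by
    obtain ⟨φ, hφ, h0⟩ := N.ne_bot_iff.1 hN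
    by_contra h
    refine h0 (E_hom_ext fun j => ?_)
    by_contra hj
    exact h ⟨j, φ, hφ, hj⟩
  -- Take the first summand of E on which some element of N is nonzero. N will consist of all maps
  -- to [1] that factor through the projection [j + 1] → [1].
  obtain ⟨j, ⟨φ, hφ, hφj⟩, hmin⟩ := WellFounded.has_min (wellFounded_lt (α := Fin n)) U hU
  suffices N = LinearMap.range
      (homMap (E k n) (Ind.proj (k := k) (n := n) (Nat.le_add_left 1 (j : ℕ)))) from
    ⟨j, ⟨(LinearEquiv.ofEq _ _ this).trans (deltaEquivRange j).symm⟩⟩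
  refine le_antisymm (fun ψ hψ => ?_) ?_
  · choose s hs using fun l => Ind.mk_surjective k 1 (ψ (single k n l (Ind.mk k _ 1)))
    classical
    -- By minimality `ψ` vanishes on summands before `j`; on a later one it is a multiple of the
    -- projection to [1], which factors through [j + 1].
    let g (l : Fin n) : Ind k n (l + 1) →ₗ[Lam k n] Ind k n (j + 1) :=
      if h : j ≤ l then s l • Ind.proj (Nat.succ_le_succ h) else 0
    let f : E k n →ₗ[Lam k n] Ind k n (j + 1) :=
      LinearMap.lsum (Lam k n) (fun l : Fin n => Ind k n (l + 1)) (Lam k n) g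
    have hf : ∀ l v, f (single k n l v) = g l v := fun l v =>
      LinearMap.lsum_piSingle (Lam k n) (fun l : Fin n => Ind k n (l + 1)) (Lam k n) g l v
    refine ⟨f, E_hom_ext fun l => ?_⟩
    rw [homMap_apply, hf]
    by_cases h : j ≤ l
    · rw [show g l = s l • Ind.proj (Nat.succ_le_succ h) from dif_pos h, LinearMap.smul_apply,
        map_smul, Ind.proj_mk, Ind.proj_mk, ← Ind.mk_eq_smul, hs]
    · rw [show g l = 0 from dif_neg h, LinearMap.zero_apply, map_zero]
      by_contra hne
      exact hmin l ⟨ψ, hψ, Ne.symm hne⟩ (not_le.1 h)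
  · rintro _ ⟨f, rfl⟩
    obtain ⟨s, hs⟩ := Ind.mk_surjective k 1 (φ (single k n j (Ind.mk k _ 1)))
    have hunit : IsUnit s := isUnit_of_not_x_dvd fun h => hφj <| by
      rw [← hs, Ind.mk_eq_zero, pow_one]
      exact h
    obtain ⟨v, rfl⟩ := hunit
    -- On the j-th summand `φ` is a unit multiple of the projection, so any map factoring through
    -- that projection is a ring multiple of `φ`.
    have hcomp : φ ∘ₗ single k n j = (v : Lam k n) • Ind.proj (Nat.le_add_left 1 (j : ℕ)) :=
      Ind.hom_ext <| by
        rw [LinearMap.comp_apply, LinearMap.smul_apply, Ind.proj_mk, ← hs, Ind.mk_eq_smul]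
    have key : homMap (E k n) (Ind.proj (Nat.le_add_left 1 (j : ℕ))) f =
        (MulOpposite.op ((↑v⁻¹ : Lam k n) • (single k n j ∘ₗ f)) : A k n) • φ := by
      refine LinearMap.ext fun e => ?_
      change Ind.proj (Nat.le_add_left 1 (j : ℕ)) (f e) = φ ((↑v⁻¹ : Lam k n) • single k n j (f e))
      rw [map_smul, show φ (single k n j (f e)) = (φ ∘ₗ single k n j) (f e) from rfl, hcomp,
        LinearMap.smul_apply, ← mul_smul, Units.inv_mul, one_smul]
    rw [key]
    exact N.smul_mem _ hφ

theorem exists_injective_of_isSimpleModule (S : Type u) [AddCommGroup S] [Module (Lam k n) S]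
    [IsSimpleModule (Lam k n) S] :
    ∃ f : S →ₗ[Lam k n] Ind k n 1, Function.Injective f := by
  obtain ⟨m, hm, ⟨e⟩⟩ := isSimpleModule_iff_quot_maximal.1 ‹IsSimpleModule (Lam k n) S›
  have hx : x k n ∈ m := hm.isPrime.mem_of_pow_mem n (by rw [x_pow_self]; exact m.zero_mem)
  have hspan : m = Ideal.span {x k n ^ 1} := by
    rw [pow_one]
    refine le_antisymm (fun a ha => ?_) ((Ideal.span_singleton_le_iff_mem _).2 hx)
    rw [Ideal.mem_span_singleton]
    by_contra h
    exact hm.ne_top (Ideal.eq_top_of_isUnit_mem _ ha (isUnit_of_not_x_dvd h))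
  let e' : S ≃ₗ[Lam k n] Ind k n 1 := e.trans (Submodule.quotEquivOfEq _ _ hspan)
  exact ⟨e'.toLinearMap, e'.injective⟩

/-- Induction on the length of V. For V' ⊂ V with simple quotient, embedded in [1], the kernel of M
→ Hom(E, [1]) embeds in Hom(E, V'), and the image is zero or a standard module. -/
theorem hasDeltaFiltration_of_injective_hom {V : Type u} [AddCommGroup V] [Module (Lam k n) V]
    (hV : IsFiniteLength (Lam k n) V) : ∀ {M : Type u} [AddCommGroup M] [Module (A k n) M]
    (f : M →ₗ[A k n] (E k n →ₗ[Lam k n] V)), Function.Injective f →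
      HasDeltaFiltration k n M := by
  induction hV with
  | of_subsingleton =>
    intro M _ _ f hf
    have : Subsingleton M := hf.subsingleton
    exact HasDeltaFiltration.of_subsingleton M
  | @of_simple_quotient V _ _ V' _ _ ih =>
    intro M _ _ f hf
    obtain ⟨g, hg⟩ := exists_injective_of_isSimpleModule (k := k) (n := n) (V ⧸ V')
    let q : V →ₗ[Lam k n] Ind k n 1 := g ∘ₗ V'.mkQ
    have hq : ∀ v, q v = 0 → v ∈ V' := fun v hv =>
      (Submodule.Quotient.mk_eq_zero _).1 (hg (hv.trans (map_zero g).symm))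
    let c : M →ₗ[A k n] P k n 1 := homMap (E k n) q ∘ₗ f
    have hker : ∀ m : LinearMap.ker c, ∀ e, f m.1 e ∈ V' := fun m e =>
      hq _ (LinearMap.congr_fun m.2 e)
    let f' : LinearMap.ker c →ₗ[A k n] (E k n →ₗ[Lam k n] V') :=
      { toFun := fun m => (f m.1).codRestrict V' (hker m)
        map_add' := fun m m' => LinearMap.ext fun e => Subtype.ext <| by
          change f (m.1 + m'.1) e = f m.1 e + f m'.1 e
          rw [map_add, LinearMap.add_apply]
        map_smul' := fun a m => LinearMap.ext fun e => Subtype.ext <| by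
          change f (a • m.1) e = f m.1 (a.unop e)
          rw [map_smul, op_smul_apply] }
    have hf' : Function.Injective f' := fun m m' h => Subtype.ext <| hf <|
      LinearMap.ext fun e => congrArg Subtype.val (LinearMap.congr_fun h e)
    refine HasDeltaFiltration.of_extension (LinearMap.ker c).subtype
      (LinearMap.ker c).injective_subtype (ih f' hf') ?_
    rw [Submodule.range_subtype]
    by_cases hc : LinearMap.range c = ⊥
    · left
      rw [LinearMap.range_eq_bot.1 hc, LinearMap.ker_zero]
    · right
      obtain ⟨j, ⟨e⟩⟩ := exists_equiv_Delta_of_ne_bot _ hc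
      exact ⟨j, ⟨c.quotKerEquivRange.trans e⟩⟩

variable {M : Type u} [AddCommGroup M] [Module (A k n) M]

theorem IsSeparated.hasDeltaFiltration {p : E k n →ₗ[Lam k n] Lam k n}
    [Module.Finite (A k n) M] (hM : IsSeparated p M) : HasDeltaFiltration k n M := by
  let _ : Module (Lam k n) M := Module.compHom M (algebraMap (Lam k n) (A k n))
  have : IsScalarTower (Lam k n) (A k n) M := IsScalarTower.of_algebraMap_smul fun _ _ => rfl
  have : Module.Finite (Lam k n) M := Module.Finite.trans (A k n) M
  exact hasDeltaFiltration_of_injective_hom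
    (isFiniteLength_iff_isNoetherian_isArtinian.2 ⟨inferInstance, inferInstance⟩) _
    hM.coext_id_injective

/-- Standard modules embed in Hom(E, [1]), which is separated, and separation passes to submodules
and extensions. -/
theorem HasDeltaFiltration.isSeparated {p : E k n →ₗ[Lam k n] Lam k n} {e₀ : E k n}
    (hp : p e₀ = 1) (h : HasDeltaFiltration k n M) : IsSeparated p M := by
  obtain ⟨m, F, hmono, h0, hm, hF⟩ := h
  have hDelta : ∀ j, IsSeparated p (Delta k n j) := fun j =>
    (isSeparated_hom hp (Ind k n 1)).of_injective
      ((Submodule.subtype _) ∘ₗ (deltaEquivRange j).toLinearMap)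
      ((Submodule.injective_subtype _).comp (deltaEquivRange j).injective)
  have hsep : ∀ j ≤ m, IsSeparated p (F j) := by
    intro j
    induction j with
    | zero =>
      intro _ y _
      exact Subtype.ext ((Submodule.mem_bot _).1 (h0.le y.2))
    | succ j ih =>
      intro hj
      obtain ⟨i, ⟨e⟩⟩ := hF j hj
      have h1 : IsSeparated p ((F j).submoduleOf (F (j + 1))) :=
        (ih (by omega)).of_injective
          (Submodule.submoduleOfEquivOfLe (hmono (Nat.le_succ j))).toLinearMap
          (Submodule.submoduleOfEquivOfLe (hmono (Nat.le_succ j))).injective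
      exact h1.of_extension ((hDelta i).of_injective e.toLinearMap e.injective)
  have hfull := hsep m le_rfl
  rw [hm] at hfull
  exact hfull.of_injective (Submodule.topEquiv (R := A k n) (M := M)).symm.toLinearMap
    (Submodule.topEquiv (R := A k n) (M := M)).symm.injective

end Filtration

end AuslanderNilpotent

theorem proposition1 (k : Type u) [Field k] (n : ℕ) (M : Type u) [AddCommGroup M]
    [Module (AuslanderNilpotent.A k n) M] [Module.Finite (AuslanderNilpotent.A k n) M] :
    List.TFAE [
      AuslanderNilpotent.IsTorsionless (AuslanderNilpotent.A k n) M,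
      Subsingleton (Abelian.Ext (ModuleCat.of (AuslanderNilpotent.A k n) M)
        (ModuleCat.of (AuslanderNilpotent.A k n) (AuslanderNilpotent.T k n)) 1),
      AuslanderNilpotent.HasDeltaFiltration k n M,
      HasProjectiveDimensionLE (ModuleCat.of (AuslanderNilpotent.A k n) M) 1,
      ∃ (I : Type u) (_ : AddCommGroup I) (_ : Module (AuslanderNilpotent.A k n) I)
        (ι : M →ₗ[AuslanderNilpotent.A k n] I),
        AuslanderNilpotent.IsInjectiveEnvelope ι ∧
          Module.Projective (AuslanderNilpotent.A k n) I] := by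
  obtain ⟨p, e₀, hp⟩ := AuslanderNilpotent.exists_generator k n
  obtain ⟨r, π, hπ⟩ := Module.Finite.exists_fin' (AuslanderNilpotent.A k n) M
  have h1 := AuslanderNilpotent.IsTorsionless.isSeparated (M := M) hp
  have h2 := AuslanderNilpotent.subsingleton_ext_one_iff_extends
    (T := AuslanderNilpotent.T k n) π hπ
  have h4 := AuslanderNilpotent.hasProjectiveDimensionLE_one_iff_projective_ker π hπ
  tfae_have 1 → 5 := fun h => AuslanderNilpotent.exists_injectiveEnvelope_projective hp (h1 h)
  tfae_have 5 → 1 := fun ⟨I, _, _, ι, hι, _⟩ =>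
    AuslanderNilpotent.isTorsionless_of_injective ι hι.injective
  tfae_have 1 → 3 := fun h => (h1 h).hasDeltaFiltration
  tfae_have 3 → 5 := fun h =>
    AuslanderNilpotent.exists_injectiveEnvelope_projective hp (h.isSeparated hp)
  tfae_have 1 → 4 := fun h => h4.2 (AuslanderNilpotent.projective_ker_of_isSeparated (h1 h))
  tfae_have 4 → 5 := fun h => by
    have := h4.1 h
    exact AuslanderNilpotent.exists_injectiveEnvelope_projective hp
      (AuslanderNilpotent.isSeparated_of_projective_ker hp π hπ)
  tfae_have 4 → 2 := fun h => by
    have := h4.1 h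
    exact h2.2 AuslanderNilpotent.extends_of_projective_ker
  tfae_have 2 → 4 := fun h => h4.2 (AuslanderNilpotent.projective_ker_of_extends (h2.1 h))
  tfae_finish
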